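/- Let $M$ be a closed oriented 3-manifold; everything is $C^\infty$. Let $T^*\mathbf M=\mathbf M\times\Omega^3(M,S^2TM)$ be the cotangent bundle of the space $\mathbf M$ of Riemannian metrics on $M$, with the symplectic form $\Omega_{(\gamma,\pi)}((h_1,\omega_1),(h_2,\omega_2))=\int_M(h_1\omega_2-h_2\omega_1)$ (contraction of indices). An orbit of the Hamiltonian dynamical system of a function $F$ on $T^*\mathbf M$ is a smooth curve in $T^*\mathbf M$, defined on an open interval, whose velocity $X$ satisfies $dF(Z)=\Omega(X,Z)$ for all tangent vectors $Z$. Put $$H_1(\gamma,\pi)=\int_M R(\gamma)\,\mathrm{vol}(\gamma),\qquad H_2(\gamma,\pi)=8\int_M\det(\pi^i_j)\,\mathrm{vol}(\gamma)^{-2},\qquad H=-\tfrac12H_1+H_2,$$ where $R(\gamma)$ is the scalar curvature. Let $P=M\times SO(3)$ and let $\mathcal M$ be the space of solder 1-forms, i.e. of horizontal $SO(3)$-equivariant $\mathbb R^3$-valued 1-forms $e=(e^1,e^2,e^3)$ on $P$ such that $\mathrm{vol}(e)=e^1\wedge e^2\wedge e^3$ vanishes nowhere and induces the orientation of $M$.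 For $e\in\mathcal M$ let $i(e)\in\mathbf M$ be the metric whose pull-back to $P$ is $\sum_i e^i\otimes e^i$. Put $\mathcal P=\mathcal M\times\Omega^3(P;\mathrm{Sym}(3))^{SO(3)}_{hor}$ and define $j:\mathcal P\to T^*\mathbf M$ by $j(e,U)=(i(e),\pi)$, where $\int_M\pi^{ij}\rho_{ij}=\int_M\mathrm{tr}(TU)$ whenever $\rho=di_e(Te)$ with $T\in\Omega^0(P;\mathrm{Sym}(3))^{SO(3)}$ and $(Te)^i=T_{ij}e^j$. A smooth curve $(e(t),U(t))$ in $\mathcal P$ is horizontal if for every $t$ its velocity has the form $(T e(t),W)$ with $T\in\Omega^0(P;\mathrm{Sym}(3))^{SO(3)}$ and $W\in\Omega^3(P;\mathrm{Sym}(3))^{SO(3)}_{hor}$. A lift of a curve $\underline c(t)$ in $T^*\mathbf M$ is a horizontal curve $c(t)$ in $\mathcal P$ with $j(c(t))=\underline c(t)$. **Proposition.** Let $c(t)=(e(t),S(t)\,\mathrm{vol}(e(t)))$ be a horizontal curve in $\mathcal P$, defined on an open interval $I$, with $S(t)\in\Omega^0(P;\mathrm{Sym}(3))^{SO(3)}$.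 Let $a,b,\kappa>0$ and put $$\alpha=2^{1/2}a^{1/2}b^{1/4}\kappa^{-3/4},\qquad \beta=b^{-1/2}\kappa^{1/2}.$$ Define $c'(t')=(e'(t'),S'(t')\,\mathrm{vol}(e'(t')))$ for $\kappa t'\in I$ by $e'(t')=\alpha e(\kappa t')$ and $S'(t')=\beta S(\kappa t')$. Then $c$ is a lift of an orbit of the Hamiltonian dynamical system of $H$ if and only if $c'$ is a lift of an orbit of the Hamiltonian dynamical system of $-aH_1+bH_2$. -/

import Mathlib

open scoped Manifold ContDiff Matrix

noncomputable section

namespace ADM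

/-- The model space of 3-manifolds. -/
abbrev E3 := EuclideanSpace ℝ (Fin 3)

abbrev Mat3 := Matrix (Fin 3) (Fin 3) ℝ

/-- The group of rotations. -/
abbrev SO3 := Matrix.specialOrthogonalGroup (Fin 3) ℝ

/-- Its Lie algebra of skew-symmetric matrices. -/
abbrev so3 := LieAlgebra.Orthogonal.so (Fin 3) ℝ

section Manifold

variable (M : Type*) [TopologicalSpace M] [ChartedSpace E3 M]

/-- The manifold `M` is oriented by its atlas: all transition maps preserve the orientation. -/
def IsOrientedAtlas : Prop :=
  ∀ φ ∈ atlas E3 M, ∀ ψ ∈ atlas E3 M, ∀ y ∈ (φ.symm.trans ψ).source,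
    0 < (fderiv ℝ (φ.symm.trans ψ) y).det

variable {M}

/-- The tangent space of `M` at `m`. -/
abbrev TM (m : M) := TangentSpace (𝓡 3) m

/-- The coordinate basis of `T_m M` given by the preferred chart at `m` (in Mathlib, this chart
identifies `T_m M` with the model space). It is positively oriented when the atlas is oriented. -/
def tbasis (m : M) : Module.Basis (Fin 3) ℝ (TM m) :=
  (EuclideanSpace.basisFun (Fin 3) ℝ).toBasis

variable (M) [IsManifold (𝓡 3) ∞ M]

/-- Smooth vector fields on `M`. -/
def VF := {X : (m : M) → TM m //
  ContMDiff (𝓡 3) (𝓡 3).tangent ∞ (fun m => (⟨m, X m⟩ : TangentBundle (𝓡 3) M))}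

/-- Smooth 1-forms on `M`: they take smooth vector fields to smooth functions. -/
def CovF := {θ : (m : M) → Module.Dual ℝ (TM m) //
  ∀ X : VF M, ContMDiff (𝓡 3) 𝓘(ℝ, ℝ) ∞ (fun m => θ m (X.1 m))}

/-- Sections of `T*M ⊗ T*M`. -/
abbrev Tens := (m : M) → TM m →ₗ[ℝ] TM m →ₗ[ℝ] ℝ

/-- 3-forms on `M`. -/
abbrev Form3 := (m : M) → TM m [⋀^Fin 3]→ₗ[ℝ] ℝ

/-- Sections of `TM ⊗ TM ⊗ Λ³T*M`, that is, bilinear forms on covectors with values in 3-forms. -/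
abbrev Mom := (m : M) →
  Module.Dual ℝ (TM m) →ₗ[ℝ] Module.Dual ℝ (TM m) →ₗ[ℝ] TM m [⋀^Fin 3]→ₗ[ℝ] ℝ

variable {M}

/-- A family of functions on `M` is jointly smooth for `t ∈ I`. -/
def SmoothFun (I : Set ℝ) (f : ℝ → M → ℝ) : Prop :=
  ContMDiffOn (𝓘(ℝ, ℝ).prod (𝓡 3)) 𝓘(ℝ, ℝ) ∞ (fun p : ℝ × M => f p.1 p.2) (I ×ˢ Set.univ)

/-- A family of covariant 2-tensor fields is smooth for `t ∈ I`. -/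
def SmoothTens (I : Set ℝ) (h : ℝ → Tens M) : Prop :=
  ∀ X Y : VF M, SmoothFun I (fun t m => h t m (X.1 m) (Y.1 m))

/-- A family of sections of `TM ⊗ TM ⊗ Λ³T*M` is smooth for `t ∈ I`. -/
def SmoothMom (I : Set ℝ) (π : ℝ → Mom M) : Prop :=
  ∀ (θ η : CovF M) (X : Fin 3 → VF M),
    SmoothFun I (fun t m => π t m (θ.1 m) (η.1 m) (fun k => (X k).1 m))

/-- `Ω⁰(M, S²T*M)`, the tangent space of the space of metrics. -/
def IsSymTens (h : Tens M) : Prop :=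
  (∀ m v w, h m v w = h m w v) ∧ SmoothTens Set.univ (fun _ => h)

/-- The space `Ω⁰(M, S²₊T*M)` of Riemannian metrics. -/
def IsMetric (γ : Tens M) : Prop :=
  IsSymTens γ ∧ ∀ m v, v ≠ 0 → 0 < γ m v v

/-- `Ω³(M, S²TM)`, the cotangent space of the space of metrics. -/
def IsMom (π : Mom M) : Prop :=
  (∀ m θ η, π m θ η = π m η θ) ∧ SmoothMom Set.univ (fun _ => π)

/-- The 3-form `π^{ij} h_{ij}`. -/
def contract (π : Mom M) (h : Tens M) : Form3 M := fun m =>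
  ∑ i, ∑ j, h m (tbasis m i) (tbasis m j) • π m ((tbasis m).coord i) ((tbasis m).coord j)

/-! ### Integration of 3-forms -/

/-- The coordinate vector fields `∂₁, ∂₂, ∂₃` of the chart at `x`, at the point with
coordinates `y`. -/
def frame (x : M) (y : E3) (i : Fin 3) : TM ((chartAt E3 x).symm y) :=
  mfderiv (𝓡 3) (𝓡 3) (chartAt E3 x).symm y (EuclideanSpace.single i (1 : ℝ) : E3)

section Integral

variable [CompactSpace M] [T2Space M]

variable (M) in
/-- A smooth partition of unity subordinate to the chart domains. -/
def partition : SmoothPartitionOfUnity M (𝓡 3) M Set.univ :=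
  Classical.choose (SmoothPartitionOfUnity.exists_isSubordinate_chartAt_source (𝓡 3) M)

/-- The integral over `M` (oriented by its atlas) of a 3-form. -/
def integral (ϖ : Form3 M) : ℝ :=
  ∑ᶠ x : M, ∫ y in (chartAt E3 x).target,
    partition M x ((chartAt E3 x).symm y) * ϖ ((chartAt E3 x).symm y) (frame x y)

end Integral

/-! ### Scalar curvature and volume form of a metric -/

/-- The partial derivative `∂_k f`. -/
def pd (k : Fin 3) (f : E3 → ℝ) (y : E3) : ℝ :=
  fderiv ℝ f y (EuclideanSpace.single k (1 : ℝ))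

/-- The Christoffel symbols `Γ^k_{ij}` of a metric `g` in coordinates. -/
def christoffel (g : E3 → Mat3) (k i j : Fin 3) (y : E3) : ℝ :=
  1 / 2 * ∑ l, (g y)⁻¹ k l *
    (pd i (fun z => g z j l) y + pd j (fun z => g z i l) y - pd l (fun z => g z i j) y)

/-- The Ricci tensor in coordinates. -/
def ricci (g : E3 → Mat3) (i j : Fin 3) (y : E3) : ℝ :=
  ∑ k, (pd k (christoffel g k i j) y - pd j (christoffel g k i k) y) +
  ∑ k, ∑ l, (christoffel g k k l y * christoffel g l i j y -
    christoffel g k j l y * christoffel g l i k y)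

/-- The components of `γ` in the chart at `x`. -/
def components (γ : Tens M) (x : M) (y : E3) : Mat3 :=
  Matrix.of fun i j => γ ((chartAt E3 x).symm y) (frame x y i) (frame x y j)

/-- The scalar curvature `R(γ)`. -/
def scalarCurv (γ : Tens M) (m : M) : ℝ :=
  ∑ i, ∑ j, (components γ m (chartAt E3 m m))⁻¹ i j *
    ricci (components γ m) i j (chartAt E3 m m)

/-- The matrix of `γ` in the coordinate basis of `T_m M`. -/
def gram (γ : Tens M) (m : M) : Mat3 :=
  Matrix.of fun i j => γ m (tbasis m i) (tbasis m j)

/-- The Riemannian volume form of `γ`. -/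
def vol (γ : Tens M) : Form3 M := fun m => Real.sqrt (gram γ m).det • (tbasis m).det

/-- The components of the symmetric 2-vector field `π / vol(γ)`. -/
def momComponents (γ : Tens M) (π : Mom M) (m : M) : Mat3 :=
  Matrix.of fun i j =>
    π m ((tbasis m).coord i) ((tbasis m).coord j) (tbasis m) / vol γ m (tbasis m)

/-- The function `det(π) / vol(γ)³`: the determinant of the endomorphism field
`π^i_j / vol(γ) = π^{ik} γ_{kj} / vol(γ)`. -/
def detMom (γ : Tens M) (π : Mom M) (m : M) : ℝ :=
  (momComponents γ π m * gram γ m).det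

/-! ### Hamiltonian systems on the cotangent bundle of the space of metrics -/

section Hamiltonian

variable [CompactSpace M] [T2Space M]

/-- `H₁(γ, π) = ∫ R(γ) vol(γ)`. -/
def H₁ (γ : Tens M) (_π : Mom M) : ℝ := integral (fun m => scalarCurv γ m • vol γ m)

/-- `H₂(γ, π) = 8 ∫ det(π) vol(γ)⁻²`. -/
def H₂ (γ : Tens M) (π : Mom M) : ℝ := 8 * integral (fun m => detMom γ π m • vol γ m)

/-- `H = -(1/2) ∫ R(γ) vol(γ) + 8 ∫ det(π) vol(γ)⁻²`. -/
def H (γ : Tens M) (π : Mom M) : ℝ := -(1 / 2) * H₁ γ π + H₂ γ π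

/-- The standard symplectic form `∫ (h₁ ϖ₂ - h₂ ϖ₁)`. -/
def symplectic (h₁ : Tens M) (ϖ₁ : Mom M) (h₂ : Tens M) (ϖ₂ : Mom M) : ℝ :=
  integral (fun m => contract ϖ₂ h₁ m - contract ϖ₁ h₂ m)

/-- The smooth curve `(γ(t), π(t))`, `t ∈ I`, is an orbit of the Hamiltonian system of `F`:
its velocity `X` satisfies `dF(Z) = Ω(X, Z)` for all tangent vectors `Z = (h, ϖ)`. -/
def IsOrbit (F : Tens M → Mom M → ℝ) (I : Set ℝ) (γ : ℝ → Tens M) (π : ℝ → Mom M) : Prop :=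
  (∀ t ∈ I, IsMetric (γ t) ∧ IsMom (π t)) ∧ SmoothTens I γ ∧ SmoothMom I π ∧
  ∀ t ∈ I, ∃ (γ' : Tens M) (π' : Mom M), IsSymTens γ' ∧ IsMom π' ∧
    (∀ m v w, HasDerivAt (fun s => γ s m v w) (γ' m v w) t) ∧
    (∀ m θ η v, HasDerivAt (fun s => π s m θ η v) (π' m θ η v) t) ∧
    ∀ (h : Tens M) (ϖ : Mom M), IsSymTens h → IsMom ϖ →
      HasDerivAt (fun s : ℝ => F (γ t + s • h) (π t + s • ϖ)) (symplectic γ' π' h ϖ) 0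

end Hamiltonian

/-! ### The principal bundle over the cotangent bundle

`P = M × SO(3)`. The tangent space of `P` at `(m, g)` is `T_m M × so(3)`, where `A ∈ so(3)` stands
for the tangent vector `g A` of `SO(3)` at `g`; so the fundamental vector field of `A` is `(0, A)`,
and right translation by `h` maps `(v, A)` at `(m, g)` to `(v, h⁻¹ A h)` at `(m, g h)`. -/

/-- The tangent spaces of `P = M × SO(3)`. -/
abbrev TP (m : M) := TM m × so3

/-- `A ↦ h⁻¹ A h`. -/
def adInv (h : SO3) : so3 →ₗ[ℝ] so3 where
  toFun A := ⟨(h : Mat3)ᵀ * (A : Mat3) * (h : Mat3), by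
    have hA := (LieAlgebra.Orthogonal.mem_so (Fin 3) ℝ (A : Mat3)).1 A.2
    rw [LieAlgebra.Orthogonal.mem_so]
    simp [Matrix.transpose_mul, hA, Matrix.mul_assoc]⟩
  map_add' A B := by ext1; simp [Matrix.mul_add, Matrix.add_mul]
  map_smul' c A := by ext1; simp

/-- The differential of right translation by `h` on `P`. -/
def dR (h : SO3) (m : M) : TP m →ₗ[ℝ] TP m := LinearMap.id.prodMap (adInv h)

variable (M)

/-- `ℝ³`-valued 1-forms on `P`. -/
abbrev POne := (u : M × SO3) → TP u.1 →ₗ[ℝ] (Fin 3 → ℝ)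

/-- Matrix-valued 3-forms on `P`. -/
abbrev PThree := (u : M × SO3) → TP u.1 [⋀^Fin 3]→ₗ[ℝ] Mat3

variable {M}

/-- A family of functions on `P` is jointly smooth for `t ∈ I`: it is smooth in every smooth
parametrization `σ` of the factor `SO(3)`. -/
def SmoothFunP (I : Set ℝ) (f : ℝ → M × SO3 → ℝ) : Prop :=
  ∀ σ : E3 → SO3, (∀ i j, ContDiff ℝ ∞ (fun x => (σ x : Mat3) i j)) →
    ContMDiffOn (𝓘(ℝ, ℝ).prod ((𝓡 3).prod (𝓡 3))) 𝓘(ℝ, ℝ) ∞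
      (fun p : ℝ × M × E3 => f p.1 (p.2.1, σ p.2.2)) (I ×ˢ Set.univ)

/-- Smooth families of matrix-valued functions on `P`. -/
def SmoothMatP (I : Set ℝ) (S : ℝ → M × SO3 → Mat3) : Prop :=
  ∀ i j, SmoothFunP I (fun t u => S t u i j)

/-- Smooth families of `ℝ³`-valued 1-forms on `P`. -/
def SmoothOneP (I : Set ℝ) (e : ℝ → POne M) : Prop :=
  ∀ (X : VF M) (A : so3) (i : Fin 3), SmoothFunP I (fun t u => e t u (X.1 u.1, A) i)

/-- Smooth families of matrix-valued 3-forms on `P`. -/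
def SmoothThreeP (I : Set ℝ) (U : ℝ → PThree M) : Prop :=
  ∀ (X : Fin 3 → VF M) (A : Fin 3 → so3) (i j : Fin 3),
    SmoothFunP I (fun t u => U t u (fun k => ((X k).1 u.1, A k)) i j)

/-- `Ω⁰(P; Sym(3))^{SO(3)}`: smooth equivariant functions with values in symmetric matrices. -/
def IsSymFun (S : M × SO3 → Mat3) : Prop :=
  (∀ u, (S u).IsSymm) ∧
  (∀ (m : M) (g h : SO3), S (m, g * h) = (h : Mat3)ᵀ * S (m, g) * (h : Mat3)) ∧
  SmoothMatP Set.univ (fun _ => S)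

/-- `Ω³(P; Sym(3))^{SO(3)}_hor`: smooth, equivariant, horizontal 3-forms with values in
symmetric matrices. -/
def IsSymForm (U : PThree M) : Prop :=
  (∀ u X, (U u X).IsSymm) ∧
  (∀ (m : M) (g h : SO3) (X : Fin 3 → TP m),
    U (m, g * h) (fun k => dR h m (X k)) = (h : Mat3)ᵀ * U (m, g) X * (h : Mat3)) ∧
  (∀ u (X : Fin 3 → TP u.1) (k : Fin 3), (X k).1 = 0 → U u X = 0) ∧
  SmoothThreeP Set.univ (fun _ => U)

/-- `vol(e) = e¹ ∧ e² ∧ e³`. -/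
def volP (e : POne M) (u : M × SO3) : TP u.1 [⋀^Fin 3]→ₗ[ℝ] ℝ :=
  (Matrix.detRowAlternating : (Fin 3 → ℝ) [⋀^Fin 3]→ₗ[ℝ] ℝ).compLinearMap (e u)

/-- Solder 1-forms: smooth, equivariant, horizontal `ℝ³`-valued 1-forms on `P` such that
`e¹ ∧ e² ∧ e³` vanishes nowhere and induces the orientation of `M`. -/
def IsSolder (e : POne M) : Prop :=
  (∀ (m : M) (g h : SO3) (X : TP m),
    e (m, g * h) (dR h m X) = (h : Mat3)ᵀ *ᵥ e (m, g) X) ∧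
  (∀ (u : M × SO3) (A : so3), e u (0, A) = 0) ∧
  SmoothOneP Set.univ (fun _ => e) ∧
  ∀ u : M × SO3, 0 < volP e u (fun k => (tbasis u.1 k, 0))

/-- The 3-form `S vol(e)`. -/
def sVol (S : M × SO3 → Mat3) (e : POne M) : PThree M := fun u =>
  (LinearMap.toSpanSingleton ℝ Mat3 (S u)).compAlternatingMap (volP e u)

/-- The 1-form `T e = (T_{ij} e^j)_i`. -/
def mulForm (T : M × SO3 → Mat3) (e : POne M) : POne M := fun u =>
  (Matrix.mulVecLin (T u)).comp (e u)

/-- `i(e) = γ`: the pull-back of `γ` to `P` is `∑ eⁱ ⊗ eⁱ`. Equivalently, the pull-backs of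
`e¹, e², e³` by local sections of `P` are orthonormal coframes of `γ`. -/
def MetricOf (e : POne M) (γ : Tens M) : Prop :=
  ∀ (u : M × SO3) (X Y : TP u.1), γ u.1 X.1 Y.1 = ∑ i, e u X i * e u Y i

/-- `i_*(e, T) = (i(e), ρ)`: the derivative of `∑ eⁱ ⊗ eⁱ` in the direction `T e` is the pull-back
of `ρ`. -/
def DMetricOf (e : POne M) (T : M × SO3 → Mat3) (ρ : Tens M) : Prop :=
  ∀ (u : M × SO3) (X Y : TP u.1), ρ u.1 X.1 Y.1 =
    ∑ i, (mulForm T e u X i * e u Y i + e u X i * mulForm T e u Y i)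

/-- The 3-form `tr(T U)` on `M`, computed with the section `m ↦ (m, 1)` of `P`. -/
def trForm (T : M × SO3 → Mat3) (U : PThree M) : Form3 M := fun m =>
  ((Matrix.traceLinearMap (Fin 3) ℝ ℝ ∘ₗ LinearMap.mulLeft ℝ (T (m, 1))).compAlternatingMap
    (U (m, 1))).compLinearMap (LinearMap.inl ℝ (TM m) so3)

section Bundle

variable [CompactSpace M] [T2Space M]

/-- `j(e, U) = (γ, π)`, where `γ = i(e)` and `⟨π, ρ⟩ = ∫ tr(T U)` for `i_*(e, T) = (γ, ρ)`. -/
def ProjectsTo (e : POne M) (U : PThree M) (γ : Tens M) (π : Mom M) : Prop :=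
  IsMetric γ ∧ IsMom π ∧ MetricOf e γ ∧
  ∀ (T : M × SO3 → Mat3) (ρ : Tens M), IsSymFun T → IsSymTens ρ → DMetricOf e T ρ →
    integral (contract π ρ) = integral (trForm T U)

/-- `(e(t), U(t))`, `t ∈ I`, is a smooth curve in the total space of the bundle `j`, horizontal for
its connection: the velocity is `(T e, W)` with `T ∈ Ω⁰(P; Sym(3))^{SO(3)}` and
`W ∈ Ω³(P; Sym(3))^{SO(3)}_hor`. -/
def IsHorizontalCurve (I : Set ℝ) (e : ℝ → POne M) (U : ℝ → PThree M) : Prop :=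
  (∀ t ∈ I, IsSolder (e t) ∧ IsSymForm (U t)) ∧ SmoothOneP I e ∧ SmoothThreeP I U ∧
  ∀ t ∈ I, ∃ (T : M × SO3 → Mat3) (W : PThree M), IsSymFun T ∧ IsSymForm W ∧
    (∀ u X i, HasDerivAt (fun s => e s u X i) (mulForm T (e t) u X i) t) ∧
    (∀ u X i j, HasDerivAt (fun s => U s u X i j) (W u X i j) t)

/-- `(e(t), U(t))`, `t ∈ I`, is a lift of an orbit of the Hamiltonian system of `F`. -/
def IsLiftOfOrbit (F : Tens M → Mom M → ℝ) (I : Set ℝ) (e : ℝ → POne M) (U : ℝ → PThree M) :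
    Prop :=
  ∃ (γ : ℝ → Tens M) (π : ℝ → Mom M), IsOrbit F I γ π ∧
    IsHorizontalCurve I e U ∧ ∀ t ∈ I, ProjectsTo (e t) (U t) (γ t) (π t)

end Bundle

end Manifold

end ADM

end

open ADM

open scoped Manifold ContDiff Matrix

noncomputable section

namespace ADM

section Scaling

variable {M : Type*} [TopologicalSpace M] [ChartedSpace E3 M]

/-! ### Smoothness of rescaled families -/

/-! Everything is homogeneous. The map `Φ(γ, π) = (α²γ, αβπ)` multiplies the symplectic form by
`α³β`, and the time change multiplies velocities by `κ`. So orbits of `F` go to orbits of `F'` as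
soon as `F' ∘ Φ = κα³β F` (`IsOrbit.rescale`). Upstairs, `e ↦ αe`, `S ↦ βS` multiplies `S vol(e)` by
`α³β` and covers `Φ` under `j` (`ProjectsTo.smul`): for fixed `T`, `ρ` scales by `α²`, which leaves
`αβ` for `π`. Since `H₁ ∘ Φ = α H₁` and `H₂ ∘ Φ = (αβ)³ H₂`, the condition for the two given
Hamiltonians follows from `κα²β = 2a` and `bβ² = κ`, which the chosen `α`, `β` satisfy. The converse
is the same argument with inverse factors. -/

theorem SmoothFun.const_mul {I : Set ℝ} {f : ℝ → M → ℝ} (hf : SmoothFun I f) (c : ℝ) :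
    SmoothFun I (fun t m => c * f t m) :=
  (contMDiff_const (c := c)).contMDiffOn.mul hf

theorem SmoothFun.comp_mul {I : Set ℝ} {f : ℝ → M → ℝ} (hf : SmoothFun I f) (κ : ℝ) :
    SmoothFun {t | κ * t ∈ I} (fun t m => f (κ * t) m) := by
  have h : ContMDiff (𝓘(ℝ, ℝ).prod (𝓡 3)) (𝓘(ℝ, ℝ).prod (𝓡 3)) ∞
      (fun p : ℝ × M => (κ * p.1, p.2)) :=
    (contMDiff_const.mul contMDiff_fst).prodMk contMDiff_snd
  exact ContMDiffOn.comp hf h.contMDiffOn fun p hp => ⟨hp.1, trivial⟩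

theorem SmoothFunP.const_mul {I : Set ℝ} {f : ℝ → M × SO3 → ℝ} (hf : SmoothFunP I f) (c : ℝ) :
    SmoothFunP I (fun t u => c * f t u) := fun σ hσ =>
  (contMDiff_const (c := c)).contMDiffOn.mul (hf σ hσ)

theorem SmoothFunP.comp_mul {I : Set ℝ} {f : ℝ → M × SO3 → ℝ} (hf : SmoothFunP I f) (κ : ℝ) :
    SmoothFunP {t | κ * t ∈ I} (fun t u => f (κ * t) u) := by
  intro σ hσ
  have h : ContMDiff (𝓘(ℝ, ℝ).prod ((𝓡 3).prod (𝓡 3))) (𝓘(ℝ, ℝ).prod ((𝓡 3).prod (𝓡 3))) ∞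
      (fun p : ℝ × M × E3 => (κ * p.1, p.2)) :=
    (contMDiff_const.mul contMDiff_fst).prodMk contMDiff_snd
  exact ContMDiffOn.comp (hf σ hσ) h.contMDiffOn fun p hp => ⟨hp.1, trivial⟩

theorem _root_.HasDerivAt.const_mul_comp_mul {f : ℝ → ℝ} {f' κ t : ℝ}
    (hf : HasDerivAt f f' (κ * t)) (c : ℝ) :
    HasDerivAt (fun s => c * f (κ * s)) (c * κ * f') t := by
  have h : HasDerivAt (fun s => κ * s) κ t := by simpa using (hasDerivAt_id t).const_mul κ
  simpa [mul_comm, mul_left_comm, mul_assoc] using (hf.comp t h).const_mul c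

/-! ### Scalar curvature and volume form of a rescaled metric -/

/-- For singular `A` both sides are the default value `0`. This lets the homogeneity of `H₁` hold
for every tensor field, not only for metrics. -/
theorem inv_smul_of_ne_zero {c : ℝ} (hc : c ≠ 0) (A : Mat3) : (c • A)⁻¹ = c⁻¹ • A⁻¹ := by
  by_cases h : IsUnit A.det
  · have := invertibleOfNonzero hc
    rw [Matrix.inv_smul A c h, invOf_eq_inv]
  · have h' : ¬ IsUnit (c • A).det := by
      rw [isUnit_iff_ne_zero, not_not] at h ⊢
      simp [h]
    rw [Matrix.nonsing_inv_apply_not_isUnit _ h, Matrix.nonsing_inv_apply_not_isUnit _ h',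
      smul_zero]

theorem pd_const_mul (k : Fin 3) (c : ℝ) (f : E3 → ℝ) (y : E3) :
    pd k (fun z => c * f z) y = c * pd k f y := by
  have h : fderiv ℝ (fun z => c * f z) = c • fderiv ℝ f := fderiv_const_smul_field c
  simp [pd, h]

/-- The factor `c⁻¹` of the inverse metric cancels the `c` of the first derivatives: a constant
conformal factor does not change the Levi-Civita connection. -/
theorem christoffel_smul {c : ℝ} (hc : c ≠ 0) (g : E3 → Mat3) (k i j : Fin 3) :
    christoffel (c • g) k i j = christoffel g k i j := by
  ext y
  simp only [christoffel, Pi.smul_apply, inv_smul_of_ne_zero hc, Matrix.smul_apply, smul_eq_mul,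
    pd_const_mul]
  congr 1
  refine Finset.sum_congr rfl fun l _ => ?_
  field_simp

theorem ricci_smul {c : ℝ} (hc : c ≠ 0) (g : E3 → Mat3) : ricci (c • g) = ricci g := by
  ext i j y
  simp only [ricci, christoffel_smul hc]

/-- The Ricci tensor is unchanged, so only the trace with the inverse metric contributes. -/
theorem scalarCurv_smul {c : ℝ} (hc : c ≠ 0) (γ : Tens M) (m : M) :
    scalarCurv (c • γ) m = c⁻¹ * scalarCurv γ m := by
  have h : components (c • γ) m = c • components γ m := by
    ext y i j
    simp [components]
  simp only [scalarCurv, h, ricci_smul hc, Pi.smul_apply, inv_smul_of_ne_zero hc,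
    Matrix.smul_apply, smul_eq_mul, Finset.mul_sum, mul_assoc]

theorem gram_smul (c : ℝ) (γ : Tens M) (m : M) : gram (c • γ) m = c • gram γ m := by
  ext i j
  simp [gram]

theorem vol_smul {α : ℝ} (hα : 0 < α) (γ : Tens M) (m : M) :
    vol (α ^ 2 • γ) m = α ^ 3 • vol γ m := by
  have h : Real.sqrt (α ^ 2 • gram γ m).det = α ^ 3 * Real.sqrt (gram γ m).det := by
    rw [Matrix.det_smul, Fintype.card_fin, show (α ^ 2) ^ 3 = (α ^ 3) ^ 2 by ring,
      Real.sqrt_mul (by positivity), Real.sqrt_sq (by positivity)]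
  rw [vol, vol, gram_smul, h, mul_smul]

/-- Division by the volume gives `μ/α³`, lowering an index gives `α²`; the determinant cubes the
product `μ/α`. -/
theorem detMom_smul {α : ℝ} (hα : 0 < α) (μ : ℝ) (γ : Tens M) (π : Mom M) (m : M) :
    detMom (α ^ 2 • γ) (μ • π) m = (μ / α) ^ 3 * detMom γ π m := by
  have h : momComponents (α ^ 2 • γ) (μ • π) m = (μ / α ^ 3) • momComponents γ π m := by
    ext i j
    simp [momComponents, vol_smul hα, mul_div_mul_comm]
  rw [detMom, detMom, h, gram_smul, Matrix.smul_mul, Matrix.mul_smul, smul_smul, Matrix.det_smul,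
    Fintype.card_fin]
  congr 2
  field_simp

theorem contract_smul_left (c : ℝ) (π : Mom M) (h : Tens M) (m : M) :
    contract (c • π) h m = c • contract π h m := by
  simp only [contract, Finset.smul_sum, Pi.smul_apply, LinearMap.smul_apply]
  exact Finset.sum_congr rfl fun i _ => Finset.sum_congr rfl fun j _ => smul_comm _ _ _

theorem contract_smul_right (c : ℝ) (π : Mom M) (h : Tens M) (m : M) :
    contract π (c • h) m = c • contract π h m := by
  simp only [contract, Finset.smul_sum, Pi.smul_apply, LinearMap.smul_apply, smul_eq_mul, mul_smul]

/-! ### Rescaled tensors and forms -/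

theorem IsSymFun.smul {S : M × SO3 → Mat3} (hS : IsSymFun S) (c : ℝ) : IsSymFun (c • S) := by
  refine ⟨fun u => (hS.1 u).smul c, fun m g h => ?_, fun i j => (hS.2.2 i j).const_mul c⟩
  simp [hS.2.1 m g h]

theorem volP_smul (c : ℝ) (e : POne M) (u : M × SO3) : volP (c • e) u = c ^ 3 • volP e u := by
  ext X
  have := (Matrix.detRowAlternating : (Fin 3 → ℝ) [⋀^Fin 3]→ₗ[ℝ] ℝ).map_smul_univ
    (fun _ => c) (fun k => e u (X k))
  simpa [volP] using this

theorem MetricOf.smul {e : POne M} {γ : Tens M} (h : MetricOf e γ) (c : ℝ) :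
    MetricOf (c • e) (c ^ 2 • γ) := by
  intro u X Y
  simp only [Pi.smul_apply, LinearMap.smul_apply, smul_eq_mul, h u X Y, Finset.mul_sum]
  exact Finset.sum_congr rfl fun i _ => by ring

theorem mulForm_smul_left (c : ℝ) (T : M × SO3 → Mat3) (e : POne M) :
    mulForm (c • T) e = c • mulForm T e := by
  funext u
  refine LinearMap.ext fun X => ?_
  simp [mulForm]

theorem mulForm_smul_right (c : ℝ) (T : M × SO3 → Mat3) (e : POne M) :
    mulForm T (c • e) = c • mulForm T e := by
  funext u
  refine LinearMap.ext fun X => ?_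
  simp [mulForm]

theorem trForm_smul (c : ℝ) (T : M × SO3 → Mat3) (U : PThree M) (m : M) :
    trForm T (c • U) m = c • trForm T U m := by
  ext X
  simp [trForm]

theorem sVol_smul (b c : ℝ) (S : M × SO3 → Mat3) (e : POne M) :
    sVol (b • S) (c • e) = (c ^ 3 * b) • sVol S e := by
  ext u X : 2
  simp [sVol, volP_smul, smul_smul]
  congr 1
  ring

theorem DMetricOf.smul {e : POne M} {T : M × SO3 → Mat3} {ρ : Tens M} (h : DMetricOf e T ρ)
    (c : ℝ) : DMetricOf (c • e) T (c ^ 2 • ρ) := by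
  intro u X Y
  simp only [Pi.smul_apply, LinearMap.smul_apply, smul_eq_mul, h u X Y, Finset.mul_sum,
    mulForm_smul_right]
  exact Finset.sum_congr rfl fun i _ => by ring

variable [IsManifold (𝓡 3) ∞ M]

/-! ### Stability of the smooth spaces and families under scaling and time change. -/

theorem SmoothTens.const_smul {I : Set ℝ} {h : ℝ → Tens M} (hh : SmoothTens I h) (c : ℝ) :
    SmoothTens I (fun t => c • h t) := fun X Y => (hh X Y).const_mul c

theorem SmoothTens.comp_mul {I : Set ℝ} {h : ℝ → Tens M} (hh : SmoothTens I h) (κ : ℝ) :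
    SmoothTens {t | κ * t ∈ I} (fun t => h (κ * t)) := fun X Y => (hh X Y).comp_mul κ

theorem SmoothMom.const_smul {I : Set ℝ} {π : ℝ → Mom M} (hπ : SmoothMom I π) (c : ℝ) :
    SmoothMom I (fun t => c • π t) := fun θ η X => (hπ θ η X).const_mul c

theorem SmoothMom.comp_mul {I : Set ℝ} {π : ℝ → Mom M} (hπ : SmoothMom I π) (κ : ℝ) :
    SmoothMom {t | κ * t ∈ I} (fun t => π (κ * t)) := fun θ η X => (hπ θ η X).comp_mul κ

theorem IsSymTens.smul {h : Tens M} (hh : IsSymTens h) (c : ℝ) : IsSymTens (c • h) :=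
  ⟨fun m v w => congrArg (c * ·) (hh.1 m v w), hh.2.const_smul c⟩

theorem IsMetric.smul {γ : Tens M} (hγ : IsMetric γ) {c : ℝ} (hc : 0 < c) : IsMetric (c • γ) :=
  ⟨hγ.1.smul c, fun m v hv => mul_pos hc (hγ.2 m v hv)⟩

theorem IsMom.smul {π : Mom M} (hπ : IsMom π) (c : ℝ) : IsMom (c • π) :=
  ⟨fun m θ η => congrArg (c • ·) (hπ.1 m θ η), hπ.2.const_smul c⟩

theorem SmoothOneP.const_smul {I : Set ℝ} {e : ℝ → POne M} (he : SmoothOneP I e) (c : ℝ) :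
    SmoothOneP I (fun t => c • e t) := fun X A i => (he X A i).const_mul c

theorem SmoothOneP.comp_mul {I : Set ℝ} {e : ℝ → POne M} (he : SmoothOneP I e) (κ : ℝ) :
    SmoothOneP {t | κ * t ∈ I} (fun t => e (κ * t)) := fun X A i => (he X A i).comp_mul κ

theorem SmoothThreeP.const_smul {I : Set ℝ} {U : ℝ → PThree M} (hU : SmoothThreeP I U) (c : ℝ) :
    SmoothThreeP I (fun t => c • U t) := fun X A i j => (hU X A i j).const_mul c

theorem SmoothThreeP.comp_mul {I : Set ℝ} {U : ℝ → PThree M} (hU : SmoothThreeP I U) (κ : ℝ) :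
    SmoothThreeP {t | κ * t ∈ I} (fun t => U (κ * t)) := fun X A i j => (hU X A i j).comp_mul κ

theorem IsSymForm.smul {U : PThree M} (hU : IsSymForm U) (c : ℝ) : IsSymForm (c • U) := by
  refine ⟨fun u X => (hU.1 u X).smul c, fun m g h X => ?_, fun u X k hk => ?_,
    hU.2.2.2.const_smul c⟩
  · simp [hU.2.1 m g h X]
  · simp [hU.2.2.1 u X k hk]

theorem IsSolder.smul {e : POne M} (he : IsSolder e) {c : ℝ} (hc : 0 < c) : IsSolder (c • e) := by
  refine ⟨fun m g h X => ?_, fun u A => ?_, he.2.2.1.const_smul c, fun u => ?_⟩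
  · simp [he.1 m g h X, Matrix.mulVec_smul]
  · simp [he.2.1 u A]
  · rw [volP_smul]
    exact mul_pos (pow_pos hc 3) (he.2.2.2 u)

/-- Reparametrizing a horizontal curve and rescaling its two components gives a horizontal
curve. -/
theorem IsHorizontalCurve.rescale {I : Set ℝ} {e : ℝ → POne M} {U : ℝ → PThree M}
    (h : IsHorizontalCurve I e U) {α : ℝ} (hα : 0 < α) (ν κ : ℝ) :
    IsHorizontalCurve {t | κ * t ∈ I} (fun t => α • e (κ * t)) (fun t => ν • U (κ * t)) := by
  refine ⟨fun t ht => ⟨(h.1 _ ht).1.smul hα, (h.1 _ ht).2.smul ν⟩,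
    (h.2.1.comp_mul κ).const_smul α, (h.2.2.1.comp_mul κ).const_smul ν, fun t ht => ?_⟩
  obtain ⟨T, W, hT, hW, he, hU⟩ := h.2.2.2 _ ht
  -- The velocity `ακ T e` equals `(κT)(αe)`: the factor `α` is absorbed by the new solder form.
  refine ⟨κ • T, (ν * κ) • W, hT.smul κ, hW.smul _, fun u X i => ?_, fun u X i j => ?_⟩
  · rw [mulForm_smul_left, mulForm_smul_right, smul_smul, mul_comm κ]
    exact (he u X i).const_mul_comp_mul α
  · exact (hU u X i j).const_mul_comp_mul ν

/-! ### Rescaling the Hamiltonian system -/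

variable [CompactSpace M] [T2Space M]

theorem integral_smul (c : ℝ) (ϖ : Form3 M) : integral (c • ϖ) = c * integral ϖ := by
  -- Neither finiteness of the support nor integrability is needed: real scalars commute with
  -- `finsum` and with the Bochner integral unconditionally.
  simp only [integral, ← smul_eq_mul (a := c), smul_finsum]
  refine finsum_congr fun x => ?_
  rw [smul_eq_mul, ← MeasureTheory.integral_const_mul]
  congr 1
  ext y
  simp
  ring

theorem H₁_smul {α : ℝ} (hα : 0 < α) (γ : Tens M) (π π' : Mom M) :
    H₁ (α ^ 2 • γ) π' = α * H₁ γ π := by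
  rw [H₁, H₁, ← integral_smul]
  congr 1
  ext1 m
  rw [scalarCurv_smul (by positivity), vol_smul hα, Pi.smul_apply, smul_smul, smul_smul]
  congr 1
  field_simp

theorem H₂_smul {α : ℝ} (hα : 0 < α) (μ : ℝ) (γ : Tens M) (π : Mom M) :
    H₂ (α ^ 2 • γ) (μ • π) = μ ^ 3 * H₂ γ π := by
  have h : (fun m => detMom (α ^ 2 • γ) (μ • π) m • vol (α ^ 2 • γ) m) =
      μ ^ 3 • fun m => detMom γ π m • vol γ m := by
    ext1 m
    rw [detMom_smul hα, vol_smul hα, Pi.smul_apply, smul_smul, smul_smul]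
    congr 1
    field_simp
  rw [H₂, H₂, h, integral_smul]
  ring

/-- Moves the scaling from the velocity to the test vector: the form is multiplied by `rs` under
`(γ, π) ↦ (rγ, sπ)`, and `κ` comes from the time change. -/
theorem symplectic_smul {r s : ℝ} (hr : r ≠ 0) (hs : s ≠ 0) (h₁ h₂ : Tens M) (ϖ₁ ϖ₂ : Mom M)
    (κ : ℝ) :
    symplectic ((r * κ) • h₁) ((s * κ) • ϖ₁) h₂ ϖ₂ =
      κ * r * s * symplectic h₁ ϖ₁ (r⁻¹ • h₂) (s⁻¹ • ϖ₂) := by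
  rw [symplectic, symplectic, ← integral_smul]
  congr 1
  ext1 m
  simp only [Pi.smul_apply, contract_smul_left, contract_smul_right, smul_sub, smul_smul]
  congr 2 <;> field_simp

/-- If `F' (r γ, s π) = κ r s F (γ, π)`, then `(γ, π) ↦ (r γ, s π)` together with the time change
`t ↦ κ t` takes orbits of `F` to orbits of `F'`. -/
theorem IsOrbit.rescale {F F' : Tens M → Mom M → ℝ} {I : Set ℝ} {γ : ℝ → Tens M} {π : ℝ → Mom M}
    (h : IsOrbit F I γ π) {r s κ : ℝ} (hr : 0 < r) (hs : s ≠ 0)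
    (hF : ∀ γ π, F' (r • γ) (s • π) = κ * r * s * F γ π) :
    IsOrbit F' {t | κ * t ∈ I} (fun t => r • γ (κ * t)) (fun t => s • π (κ * t)) := by
  refine ⟨fun t ht => ⟨(h.1 _ ht).1.smul hr, (h.1 _ ht).2.smul s⟩,
    (h.2.1.comp_mul κ).const_smul r, (h.2.2.1.comp_mul κ).const_smul s, fun t ht => ?_⟩
  obtain ⟨γ', π', hγ', hπ', dγ, dπ, hd⟩ := h.2.2.2 _ ht
  refine ⟨(r * κ) • γ', (s * κ) • π', hγ'.smul _, hπ'.smul _, fun m v w => (dγ m v w).const_mul_comp_mul r,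
    fun m θ η v => (dπ m θ η v).const_mul_comp_mul s, fun k ϖ hk hϖ => ?_⟩
  -- The original equation is tested on the preimage of `(k, ϖ)` under the scaling; `hF` then
  -- identifies the two functions of `q` exactly.
  have := (hd (r⁻¹ • k) (s⁻¹ • ϖ) (hk.smul _) (hϖ.smul _)).const_mul (κ * r * s)
  rw [symplectic_smul hr.ne' hs]
  refine this.congr_of_eventuallyEq (.of_forall fun q => ?_)
  dsimp only
  rw [← hF, smul_add, smul_add, smul_comm r q, smul_comm s q, smul_inv_smul₀ hr.ne',
    smul_inv_smul₀ hs]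

/-! ### Scaling of the projection `j` and of lifts of orbits. -/

theorem ProjectsTo.smul {e : POne M} {U : PThree M} {γ : Tens M} {π : Mom M}
    (h : ProjectsTo e U γ π) {α : ℝ} (hα : 0 < α) (β : ℝ) :
    ProjectsTo (α • e) ((α ^ 3 * β) • U) (α ^ 2 • γ) ((α * β) • π) := by
  refine ⟨h.1.smul (by positivity), h.2.1.smul _, h.2.2.1.smul α, fun T ρ hT hρ hTρ => ?_⟩
  -- The same `T` serves for `e` and `αe`; only the induced variation of the metric changes,
  -- quadratically in `α`.
  have hTρ' : DMetricOf e T ((α⁻¹) ^ 2 • ρ) := by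
    simpa [smul_smul, hα.ne'] using hTρ.smul α⁻¹
  have h' := h.2.2.2 T _ hT (hρ.smul _) hTρ'
  have h₁ : contract ((α * β) • π) ρ = (α ^ 3 * β) • contract π ((α⁻¹) ^ 2 • ρ) := by
    ext1 m
    rw [contract_smul_left, Pi.smul_apply, contract_smul_right, smul_smul]
    congr 1
    field_simp
  have h₂ : trForm T ((α ^ 3 * β) • U) = (α ^ 3 * β) • trForm T U := by
    ext1 m
    rw [trForm_smul, Pi.smul_apply]
  rw [h₁, h₂, integral_smul, integral_smul, h']

/-- If `F' (α² γ, α β π) = κ α³ β F (γ, π)`, then `(e, U) ↦ (α e, α³ β U)` together with the time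
change `t ↦ κ t` takes lifts of orbits of `F` to lifts of orbits of `F'`. -/
theorem IsLiftOfOrbit.rescale {F F' : Tens M → Mom M → ℝ} {I : Set ℝ} {e : ℝ → POne M}
    {U : ℝ → PThree M} (h : IsLiftOfOrbit F I e U) {α β κ : ℝ} (hα : 0 < α) (hβ : 0 < β)
    (hF : ∀ γ π, F' (α ^ 2 • γ) ((α * β) • π) = κ * α ^ 2 * (α * β) * F γ π) :
    IsLiftOfOrbit F' {t | κ * t ∈ I} (fun t => α • e (κ * t))
      (fun t => (α ^ 3 * β) • U (κ * t)) := by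
  obtain ⟨γ, π, ho, hc, hp⟩ := h
  exact ⟨_, _, ho.rescale (by positivity) (by positivity) hF, hc.rescale hα _ κ,
    fun t ht => (hp _ ht).smul hα β⟩

theorem isLiftOfOrbit_rescale_iff {F F' : Tens M → Mom M → ℝ} {I : Set ℝ} {e : ℝ → POne M}
    {U : ℝ → PThree M} {α β κ : ℝ} (hα : 0 < α) (hβ : 0 < β) (hκ : 0 < κ)
    (hF : ∀ γ π, F' (α ^ 2 • γ) ((α * β) • π) = κ * α ^ 2 * (α * β) * F γ π) :
    IsLiftOfOrbit F I e U ↔ IsLiftOfOrbit F' {t | κ * t ∈ I} (fun t => α • e (κ * t))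
      (fun t => (α ^ 3 * β) • U (κ * t)) := by
  refine ⟨fun h => h.rescale hα hβ hF, fun h => ?_⟩
  -- The homogeneity relation of the inverse scaling, obtained by evaluating `hF` at the inverse
  -- image of `(γ, π)`.
  have hF' : ∀ γ π, F (α⁻¹ ^ 2 • γ) ((α⁻¹ * β⁻¹) • π) =
      κ⁻¹ * α⁻¹ ^ 2 * (α⁻¹ * β⁻¹) * F' γ π := by
    intro γ π
    have := hF (α⁻¹ ^ 2 • γ) ((α⁻¹ * β⁻¹) • π)
    rw [smul_smul, smul_smul, show α ^ 2 * α⁻¹ ^ 2 = 1 by field_simp,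
      show α * β * (α⁻¹ * β⁻¹) = 1 by field_simp, one_smul, one_smul] at this
    rw [this]
    field_simp
  have := h.rescale (inv_pos.2 hα) (inv_pos.2 hβ) hF'
  have hν : α⁻¹ ^ 3 * β⁻¹ * (α ^ 3 * β) = 1 := by field_simp
  simpa only [Set.mem_ofPred_eq, mul_inv_cancel_left₀ hκ.ne', Set.ofPred_mem_eq, smul_smul, hν,
    inv_mul_cancel₀ hα.ne', one_smul] using this

/-- The identities between the scaling factors of `H₁`, `H₂` and the symplectic form. -/
theorem scaling_constants {a b κ α β : ℝ} (ha : 0 < a) (hb : 0 < b) (hκ : 0 < κ)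
    (hα : α = 2 ^ (1 / 2 : ℝ) * a ^ (1 / 2 : ℝ) * b ^ (1 / 4 : ℝ) * κ ^ (-(3 / 4) : ℝ))
    (hβ : β = b ^ (-(1 / 2) : ℝ) * κ ^ (1 / 2 : ℝ)) :
    b * β ^ 2 = κ ∧ κ * α ^ 2 * β = 2 * a := by
  have hβ2 : β ^ 2 = b⁻¹ * κ := by
    rw [hβ, mul_pow, ← Real.rpow_mul_natCast hb.le, ← Real.rpow_mul_natCast hκ.le]
    norm_num [Real.rpow_neg_one]
  have hα2 : α ^ 2 = 2 * a * b ^ (1 / 2 : ℝ) * κ ^ (-(3 / 2) : ℝ) := by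
    rw [hα, mul_pow, mul_pow, mul_pow, ← Real.rpow_mul_natCast hb.le,
      ← Real.rpow_mul_natCast hκ.le, ← Real.rpow_mul_natCast ha.le,
      ← Real.rpow_mul_natCast zero_le_two]
    norm_num
  refine ⟨by rw [hβ2]; field_simp, ?_⟩
  have h₁ : b ^ (1 / 2 : ℝ) * b ^ (-(1 / 2) : ℝ) = 1 := by
    rw [← Real.rpow_add hb]; norm_num
  have h₂ : κ * (κ ^ (-(3 / 2) : ℝ) * κ ^ (1 / 2 : ℝ)) = 1 := by
    rw [← Real.rpow_add hκ]; norm_num [Real.rpow_neg_one, hκ.ne']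
  calc κ * α ^ 2 * β = 2 * a * (b ^ (1 / 2 : ℝ) * b ^ (-(1 / 2) : ℝ)) *
        (κ * (κ ^ (-(3 / 2) : ℝ) * κ ^ (1 / 2 : ℝ))) := by rw [hα2, hβ]; ring
    _ = 2 * a := by rw [h₁, h₂]; ring

end Scaling

end ADM

end

theorem proposition5p1 {M : Type*} [TopologicalSpace M] [ChartedSpace E3 M]
    [IsManifold (𝓡 3) ∞ M] [CompactSpace M] [T2Space M] (hM : IsOrientedAtlas M)
    (I : Set ℝ) (hI : IsOpen I) (hI' : I.OrdConnected)
    (e : ℝ → POne M) (S : ℝ → M × SO3 → Mat3)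
    (hS : ∀ t ∈ I, IsSymFun (S t))
    (hc : IsHorizontalCurve I e (fun t => sVol (S t) (e t)))
    (a b κ α β : ℝ) (ha : 0 < a) (hb : 0 < b) (hκ : 0 < κ)
    (hα : α = 2 ^ (1 / 2 : ℝ) * a ^ (1 / 2 : ℝ) * b ^ (1 / 4 : ℝ) * κ ^ (-(3 / 4) : ℝ))
    (hβ : β = b ^ (-(1 / 2) : ℝ) * κ ^ (1 / 2 : ℝ))
    (e' : ℝ → POne M) (S' : ℝ → M × SO3 → Mat3)
    (he' : ∀ t', e' t' = α • e (κ * t')) (hS' : ∀ t', S' t' = β • S (κ * t')) :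
    IsLiftOfOrbit H I e (fun t => sVol (S t) (e t)) ↔
      IsLiftOfOrbit (fun γ π => -a * H₁ γ π + b * H₂ γ π) {t' : ℝ | κ * t' ∈ I}
        e' (fun t' => sVol (S' t') (e' t')) := by
  obtain ⟨h₁, h₂⟩ := scaling_constants ha hb hκ hα hβ
  have hα₀ : 0 < α := by rw [hα]; positivity
  have hβ₀ : 0 < β := by rw [hβ]; positivity
  rw [isLiftOfOrbit_rescale_iff (F' := fun γ π => -a * H₁ γ π + b * H₂ γ π) hα₀ hβ₀ hκ]
  · have he : e' = fun t' => α • e (κ * t') := funext he'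
    simp only [he, hS', sVol_smul]
  · intro γ π
    rw [H₁_smul hα₀ γ π, H₂_smul hα₀, H]
    -- The coefficients of `H₁` match by `κα²β = 2a`, those of `H₂` by `bβ² = κ`.
    linear_combination (α * H₁ γ π / 2) * h₂ + (α ^ 3 * β * H₂ γ π) * h₁
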